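/- Let $P$ be a poset, regarded as a category with one arrow $i\to j$ whenever $i\le j$. Assume that $P$ is graded by a decreasing degree function $\deg:P\to\{0,1,2,\dots\}$ (that is, $\deg$ is order-reversing, and $\deg(i)=\deg(j)+1$ whenever $j$ covers $i$) and bounded (that is, $\deg$ is also bounded from above). Write $\mathrm{Ob}_p(P)=\{i:\deg(i)=p\}$, $(i\downarrow P)_p=\{j\ge i:\deg(j)=p\}$ and $(i\downarrow P)_*=\{j: j>i\}$. Assume that $\mathrm{Ob}_0(P)\ne\emptyset$, that every set $(i\downarrow P)_p$ is finite, and that all maximal elements of $P$ have the same degree. Define integers $R^i_p$ for $\deg(i)\ge p\geq 0$ by $R^i_0=1$ and $R^i_{p}=\sum_{j\in(i\downarrow P)_{p-1}}R^j_{p-1}-R^i_{p-1}$ for $p\ge 1$. **Adequate covering family.** A covering family is a family of subsets $J^i_p\subseteq(i\downarrow P)_p$ ($i\in P$, $0\le p\le\deg(i)$) such that for all $i$ and $0\le p<\deg(i)$ one has $\bigcup_{j\in J^i_{p+1}}(j\downarrow P)_p=(i\downarrow P)_p$, and $J^j_p\subseteq J^i_p$ for every $j\in J^i_{p+1}$.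 It is adequate if $(i\downarrow P)_*$ is connected whenever $\deg(i)\ge2$, and $R^i_p=\sum_{j\in J^i_p}R^j_p$ whenever $p\ge 0$ and $\deg(i)\ge p+1$. **The functors $F_p$.** Let $F_0=c_{\mathbb Z}:P\to\mathrm{Ab}$ be the constant functor with value $\mathbb Z$ and, for $p\ge1$, let $F_p(i)$ be the cokernel of the homomorphism $F_{p-1}(i)\to\prod_{j\in(i\downarrow P)_{p-1}}F_{p-1}(j)$ whose components are the maps $F_{p-1}(i\to j)$; the maps $F_p(i\to k)$ are induced by the projections. The quotient maps induce a homomorphism $\omega_p:\prod_{i\in\mathrm{Ob}_{p-1}(P)}F_{p-1}(i)\to\varprojlim F_p$. **Adequate global covering family.** Call a homomorphism of abelian groups pure if its cokernel is a free abelian group. A global covering family is a family of subsets $K_p\subseteq\mathrm{Ob}_p(P)$ ($p\ge0$) such that the restriction map $\varprojlim F_p\to\prod_{i\in K_p}F_p(i)$ is injective for every $p\ge0$, is pure for $p=0$, and, for every $p\ge1$, the composite $$\prod_{i\in\mathrm{Ob}_{p-1}(P)\setminus K_{p-1}}F_{p-1}(i)\hookrightarrow\prod_{i\in\mathrm{Ob}_{p-1}(P)}F_{p-1}(i)\xrightarrow{\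 \omega_p\ }\varprojlim F_p\to\prod_{i\in K_p}F_p(i)$$ is pure. It is adequate if, for every $p\ge 0$, only finitely many $i\in \mathrm{Ob}_p(P)$ have $R^i_p\neq 0$ and, for every $p\ge1$, $$\sum_{i\in\mathrm{Ob}_{p-1}(P)}R^i_{p-1}=\sum_{i\in K_{p-1}}R^i_{p-1}+\sum_{i\in K_p}R^i_p .$$ **Theorem.** Suppose that $P$ has an adequate covering family, and let $K=\{K_p\}_{p\ge0}$ be an adequate global covering family. Let $H^n(P;\mathbb Z)=\varprojlim^n c_{\mathbb Z}$ be the cohomology of the cochain complex of the nerve of $P$. Then $P$ is acyclic (that is, $H^n(P;\mathbb Z)=0$ for all $n\ge1$) if and only if $|K_0|$ equals the number of connected components of $P$. Moreover, in this case $H^0(P;\mathbb Z)\cong\mathbb Z^{|K_0|}$. -/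

import Mathlib

open CategoryTheory

universe u

namespace GradedPosets

/-- A poset `P`, viewed as a category with one arrow `i ⟶ j` for each `i ≤ j`, with a decreasing
degree function with values in `{..., 2, 1, 0}` such that some object has degree `0`, every
`(i ↓ P)_n` is finite, and all maximal elements have the same degree. Since the degrees are natural
numbers, `P` is bounded above. -/
structure Grading (P : Type u) [PartialOrder P] where
  /-- The degree function. -/
  deg : P → ℕ
  antitone : Antitone deg
  deg_of_covBy : ∀ {i j : P}, i ⋖ j → deg i = deg j + 1
  exists_deg_zero : ∃ i, deg i = 0
  finite_above : ∀ (i : P) (n : ℕ), {j : P | i ≤ j ∧ deg j = n}.Finite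
  deg_eq_of_isMax : ∀ {i j : P}, IsMax i → IsMax j → deg i = deg j

variable {P : Type u} [PartialOrder P]

namespace Grading

/-- `Ob_n(P)`: the objects of degree `n`. -/
def level (g : Grading P) (n : ℕ) : Set P := {j | g.deg j = n}

/-- `(i ↓ P)_n`: the objects `j` of degree `n` with an arrow `i ⟶ j`. -/
def above (g : Grading P) (i : P) (n : ℕ) : Set P := {j | i ≤ j ∧ g.deg j = n}

/-- `P` is bounded below: the (decreasing) degree function has an upper bound. Together with the
bound above that is part of `Grading`, this says that `P` is bounded. -/
def BoundedBelow (g : Grading P) : Prop := BddAbove (Set.range g.deg)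

/-! ### Local covering families -/

/-- `J i p`, for `p ≤ deg i`, is a covering family (the values for `p > deg i` are irrelevant). -/
structure IsCoveringFamily (g : Grading P) (J : P → ℕ → Set P) : Prop where
  subset_above : ∀ i p, p ≤ g.deg i → J i p ⊆ g.above i p
  covering : ∀ i p, p < g.deg i → ⋃ j ∈ J i (p + 1), g.above j p = g.above i p
  inheritance : ∀ i p, p < g.deg i → ∀ j ∈ J i (p + 1), J j p ⊆ J i p

/-- The numbers `R^i_p`: `R^i_0 = 1` and
`R^i_{p+1} = ∑_{j ∈ (i ↓ P)_p} R^j_p - R^i_p` (meaningful for `p ≤ deg i`). -/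
noncomputable def rankNumber (g : Grading P) : ℕ → P → ℤ
  | 0, _ => 1
  | p + 1, i => (∑ᶠ j ∈ g.above i p, rankNumber g p j) - rankNumber g p i

/-- An adequate (local) covering family. `Set.Ioi i` is the category `(i ↓ P)_*`. -/
structure IsAdequateCoveringFamily (g : Grading P) (J : P → ℕ → Set P) : Prop
    extends g.IsCoveringFamily J where
  connected : ∀ i, 2 ≤ g.deg i → IsConnected (Set.Ioi i)
  rankNumber_eq : ∀ i p, p + 1 ≤ g.deg i →
    g.rankNumber p i = ∑ᶠ j ∈ J i p, g.rankNumber p j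

/-! ### The sequence of functors `F₀ = c_ℤ, F₁, F₂, ...` -/

/-- The homomorphism `F(i) → ∏_{j ∈ (i ↓ P)_p} F(j)` whose components are the maps `F(i ⟶ j)`.
If `F` is `p`-condensed, then the product is `ker'_F(i)` and this is `λ_i`. -/
def diagonal (g : Grading P) (p : ℕ) (F : P ⥤ AddCommGrpCat.{u}) (i : P) :
    F.obj i →+ ((j : g.above i p) → F.obj j) where
  toFun x j := (F.map (homOfLE j.2.1)).hom x
  map_zero' := by funext j; exact map_zero _
  map_add' x y := by funext j; exact map_add _ x y

/-- For `i ≤ k`, the projection `∏_{j ∈ (i ↓ P)_p} F(j) → ∏_{j ∈ (k ↓ P)_p} F(j)`. -/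
def projection (g : Grading P) (p : ℕ) (F : P ⥤ AddCommGrpCat.{u}) {i k : P} (h : i ≤ k) :
    ((j : g.above i p) → F.obj j) →+ ((j : g.above k p) → F.obj j) where
  toFun x j := x ⟨j.1, h.trans j.2.1, j.2.2⟩
  map_zero' := rfl
  map_add' _ _ := rfl

theorem projection_diagonal (g : Grading P) (p : ℕ) (F : P ⥤ AddCommGrpCat.{u}) {i k : P}
    (h : i ≤ k) (x : F.obj i) :
    g.projection p F h (g.diagonal p F i x) = g.diagonal p F k ((F.map (homOfLE h)).hom x) := by
  funext j
  change (F.map (homOfLE _)).hom x = (F.map (homOfLE _)).hom ((F.map (homOfLE h)).hom x)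
  rw [← homOfLE_comp h j.2.1, F.map_comp]
  rfl

/-- The object-wise cokernel of `λ : F ⟹ ker'_F` for a `p`-condensed functor `F`:
`i ↦ (∏_{j ∈ (i ↓ P)_p} F(j)) / λ_i(F(i))`. -/
def nextFunctor (g : Grading P) (p : ℕ) (F : P ⥤ AddCommGrpCat.{u}) :
    P ⥤ AddCommGrpCat.{u} where
  obj i := AddCommGrpCat.of (((j : g.above i p) → F.obj j) ⧸ (g.diagonal p F i).range)
  map {i k} f := AddCommGrpCat.ofHom (QuotientAddGroup.map _ _ (g.projection p F (leOfHom f)) (by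
    rintro _ ⟨x, rfl⟩
    exact ⟨_, (g.projection_diagonal p F (leOfHom f) x).symm⟩))
  map_id i := by
    ext x
    rfl
  map_comp f h := by
    ext x
    rfl

/-- The constant functor `c_ℤ`. -/
def constInt (P : Type u) [PartialOrder P] : P ⥤ AddCommGrpCat.{u} :=
  (Functor.const P).obj (AddCommGrpCat.of (ULift.{u} ℤ))

/-- The functors `F₀ = c_ℤ`, `F_{p+1} = Coker (λ_p : F_p ⟹ ker'_{F_p})`. -/
def seqFunctor (g : Grading P) : ℕ → (P ⥤ AddCommGrpCat.{u})
  | 0 => constInt P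
  | p + 1 => g.nextFunctor p (seqFunctor g p)

end Grading

/-- `lim F`: the group of compatible families of elements of the `F(i)`. -/
def lim (F : P ⥤ AddCommGrpCat.{u}) : AddSubgroup ((i : P) → F.obj i) where
  carrier := {x | ∀ (i j : P) (f : i ⟶ j), (F.map f).hom (x i) = x j}
  zero_mem' _ _ f := map_zero (F.map f).hom
  add_mem' {x y} hx hy i j f := by
    change (F.map f).hom (x i + y i) = x j + y j
    rw [map_add, hx, hy]
  neg_mem' {x} hx i j f := by
    change (F.map f).hom (-x i) = -x j
    rw [map_neg, hx]

/-- `∏_{i ∈ S} F(i)`. -/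
abbrev prodOver (F : P ⥤ AddCommGrpCat.{u}) (S : Set P) : Type u := (i : S) → F.obj i

/-- The restriction map `lim F → ∏_{i ∈ S} F(i)`. -/
def limRestrict (F : P ⥤ AddCommGrpCat.{u}) (S : Set P) : lim F →+ prodOver F S where
  toFun x i := x.1 i
  map_zero' := rfl
  map_add' _ _ := rfl

/-- A homomorphism (between free abelian groups) is pure if its cokernel is free. -/
def IsPure {A B : Type u} [AddCommGroup A] [AddCommGroup B] (f : A →+ B) : Prop :=
  Module.Free ℤ (B ⧸ f.range)

namespace Grading

/-- `ω_{p+1} : ∏_{i ∈ Ob_p(P)} F_p(i) = lim ker'_{F_p} → lim F_{p+1}`, induced by the quotient map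
`ker'_{F_p} ⟹ F_{p+1}`. -/
def omega (g : Grading P) (p : ℕ) :
    prodOver (g.seqFunctor p) (g.level p) →+ lim (g.seqFunctor (p + 1)) where
  toFun x := ⟨fun i => QuotientAddGroup.mk' (g.diagonal p (g.seqFunctor p) i).range
    fun j : g.above i p => x ⟨j.1, j.2.2⟩, fun _ _ _ => rfl⟩
  map_zero' := rfl
  map_add' _ _ := rfl

open Classical in
/-- Extension by zero `∏_{i ∈ Ob_p(P) ∖ S} F_p(i) → ∏_{i ∈ Ob_p(P)} F_p(i)`. -/
noncomputable def extendZero (g : Grading P) (p : ℕ) (S : Set P) :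
    prodOver (g.seqFunctor p) (g.level p \ S) →+ prodOver (g.seqFunctor p) (g.level p) where
  toFun x i := if h : (i : P) ∈ S then 0 else x ⟨i.1, i.2, h⟩
  map_zero' := by
    funext i
    by_cases h : (i : P) ∈ S <;> simp [h]
  map_add' x y := by
    funext i
    by_cases h : (i : P) ∈ S <;> simp [h]

/-! ### Global covering families -/

/-- A global covering family `K = {K_p}`. -/
structure IsGlobalCoveringFamily (g : Grading P) (K : ℕ → Set P) : Prop where
  subset_level : ∀ p, K p ⊆ g.level p
  /-- `lim F_p → ∏_{i ∈ K_p} F_p(i)` is a monomorphism. -/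
  restrict_injective : ∀ p, Function.Injective (limRestrict (g.seqFunctor p) (K p))
  /-- `lim F_0 → ∏_{i ∈ K_0} F_0(i)` is pure. -/
  restrict_pure : IsPure (limRestrict (g.seqFunctor 0) (K 0))
  /-- `∏_{i ∈ Ob_p(P) ∖ K_p} F_p(i) → ∏_{i ∈ K_{p+1}} F_{p+1}(i)` is pure. -/
  omega_pure : ∀ p, IsPure
    ((limRestrict (g.seqFunctor (p + 1)) (K (p + 1))).comp
      ((g.omega p).comp (g.extendZero p (K p))))

/-- An adequate global covering family. The first condition says that the sums in the second one,
which is an equation between integers, are finite. -/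
structure IsAdequateGlobalCoveringFamily (g : Grading P) (K : ℕ → Set P) : Prop
    extends g.IsGlobalCoveringFamily K where
  finite_support : ∀ p, {i ∈ g.level p | g.rankNumber p i ≠ 0}.Finite
  sum_eq : ∀ p, ∑ᶠ i ∈ g.level p, g.rankNumber p i =
    (∑ᶠ i ∈ K p, g.rankNumber p i) + ∑ᶠ i ∈ K (p + 1), g.rankNumber (p + 1) i

end Grading

/-! ### Higher limits and cohomology -/

/-- `C^n(P, F) = ∏_σ F(σ_n)`, the product over the `n`-simplices `σ_0 ≤ ... ≤ σ_n` of the nerve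
of `P`. -/
abbrev Cochain (F : P ⥤ AddCommGrpCat.{u}) (n : ℕ) : Type u :=
  (σ : Fin (n + 1) →o P) → F.obj (σ (Fin.last n))

/-- The coface map `d^k : C^n(P, F) → C^{n+1}(P, F)`, where `(d^k f)(σ)` is the image of
`f(d_k σ)` in `F(σ_{n+1})` under the map induced by the arrow from the last vertex of `d_k σ` to
`σ_{n+1}` (for `k ≤ n` this arrow is the identity). -/
def coface (F : P ⥤ AddCommGrpCat.{u}) (n : ℕ) (k : Fin (n + 2)) :
    Cochain F n →+ Cochain F (n + 1) where
  toFun f σ := (F.map (homOfLE (σ.monotone (Fin.le_last (k.succAbove (Fin.last n)))))).hom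
    (f (σ.comp k.succAboveOrderEmb.toOrderHom))
  map_zero' := by funext σ; exact map_zero _
  map_add' f f' := by funext σ; exact map_add _ _ _

/-- The differential `d = ∑_k (-1)^k d^k : C^n(P, F) → C^{n+1}(P, F)`. -/
def differential (F : P ⥤ AddCommGrpCat.{u}) (n : ℕ) : Cochain F n →+ Cochain F (n + 1) :=
  ∑ k : Fin (n + 2), (-1 : ℤ) ^ (k : ℕ) • coface F n k

/-- The `n`-coboundaries. -/
def coboundaries (F : P ⥤ AddCommGrpCat.{u}) : (n : ℕ) → AddSubgroup (Cochain F n)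
  | 0 => ⊥
  | n + 1 => (differential F n).range

/-- The higher limit `lim^n F`: the `n`-cocycles modulo the `n`-coboundaries. -/
abbrev HigherLim (F : P ⥤ AddCommGrpCat.{u}) (n : ℕ) : Type u :=
  (differential F n).ker ⧸ (coboundaries F n).addSubgroupOf (differential F n).ker

/-- `H^n(P; ℤ) = lim^n c_ℤ`. -/
abbrev Cohomology (P : Type u) [PartialOrder P] (n : ℕ) : Type u :=
  HigherLim (Grading.constInt P) n

/-- `P` is acyclic: `H^n(P; ℤ) = 0` for all `n ≥ 1`. -/
def IsAcyclic (P : Type u) [PartialOrder P] : Prop :=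
  ∀ n : ℕ, 1 ≤ n → Subsingleton (Cohomology P n)

end GradedPosets

/-!
Both sides of the equivalence follow from the hypotheses, by counting ranks.

*Local part.* Let `ker' F` denote the functor `i ↦ ∏_{j ∈ (i ↓ P)_p} F(j)`. By induction on `p`, the
group `F_p(i)` is free of rank `R^i_p` for `p ≤ deg i`, and for `p < deg i` the restriction
`F_p(i) → ∏_{j ∈ J i p} F_p(j)` is bijective (`Grading.isRanked_seqFunctor`). For the induction step,
normalize representatives of classes in `F_{p+1}(i)` to vanish on `J i p`; the covering and
inheritance conditions then say that the restriction over `J i (p + 1)` is injective with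
torsion-free cokernel, and equality of ranks makes it surjective. In particular
`0 → F_p → ker' F_p → F_{p+1} → 0` is exact.

*Global part.* The composite
`∏_{Ob_p(P) ∖ K_p} F_p → ∏_{Ob_p(P)} F_p → lim F_{p+1} → ∏_{K_{p+1}} F_{p+1}` is injective because an
element of its kernel is an element of `lim F_p` that vanishes on `K_p`. It is pure, and adequacy says
that its source and target have the same finite rank, so it is bijective. Hence `ω_{p+1}` is
surjective (`Grading.omega_surjective`), and the restriction `lim F_p → ∏_{K_p} F_p` is bijective
(`Grading.limRestrict_bijective`).

*Cohomology.* The higher limits of `ker' F_p` vanish, since its cochain complex is a product of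
complexes of cones (`Grading.higherLimVanishes_kerFunctor`). Dimension shifting identifies
`H^n(P; ℤ)` with the cokernel of `ω_n` for `n ≥ 1`, so `P` is acyclic. Finally
`H^0(P; ℤ) = lim c_ℤ` restricts isomorphically to `∏_{K_0} ℤ`, which forces `K_0` to meet each
connected component exactly once.
-/

/-! ### Ranks of finitely generated free abelian groups -/

section Ranks

variable {ι : Type*} {M : ι → Type*} [∀ i, AddCommGroup (M i)] [∀ i, Module.Free ℤ (M i)]
  [∀ i, Module.Finite ℤ (M i)]

/-- Factors of rank zero are trivial, so a product restricts isomorphically to the other factors. -/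
theorem exists_linearEquiv_pi_support :
    Nonempty ((∀ i, M i) ≃ₗ[ℤ] ∀ i : {i | Module.finrank ℤ (M i) ≠ 0}, M i) := by
  refine ⟨LinearEquiv.ofBijective
    (LinearMap.pi fun i : {i | Module.finrank ℤ (M i) ≠ 0} ↦ LinearMap.proj i.1) ⟨?_, ?_⟩⟩
  · intro x y h
    funext i
    by_cases hi : Module.finrank ℤ (M i) = 0
    · have : Subsingleton (M i) := Module.finrank_zero_iff.mp hi
      exact Subsingleton.elim _ _
    · exact congrFun h ⟨i, hi⟩
  · intro y
    classical
    refine ⟨fun i ↦ if hi : Module.finrank ℤ (M i) ≠ 0 then y ⟨i, hi⟩ else 0, ?_⟩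
    funext i
    exact dif_pos i.2

theorem finite_pi_of_finite_support (h : {i | Module.finrank ℤ (M i) ≠ 0}.Finite) :
    Module.Finite ℤ (∀ i, M i) := by
  have := h.to_subtype
  obtain ⟨e⟩ := exists_linearEquiv_pi_support (M := M)
  exact Module.Finite.equiv e.symm

theorem finrank_pi_of_finite_support (h : {i | Module.finrank ℤ (M i) ≠ 0}.Finite) :
    Module.finrank ℤ (∀ i, M i) = ∑ᶠ i, Module.finrank ℤ (M i) := by
  have := h.to_subtype
  have := Fintype.ofFinite {i | Module.finrank ℤ (M i) ≠ 0}
  obtain ⟨e⟩ := exists_linearEquiv_pi_support (M := M)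
  rw [e.finrank_eq, Module.finrank_pi_fintype, ← finsum_eq_sum_of_fintype]
  exact finsum_set_coe_eq_finsum_mem (f := fun i ↦ Module.finrank ℤ (M i)) _ |>.trans
    (finsum_mem_support _)

end Ranks

/-- An injective homomorphism between groups of equal rank has torsion cokernel. -/
theorem exists_smul_mem_range_of_finrank_eq {A B : Type*} [AddCommGroup A] [AddCommGroup B]
    [Module.Finite ℤ B] (f : A →+ B) (hf : Function.Injective f)
    (h : Module.finrank ℤ A = Module.finrank ℤ B) (b : B) : ∃ n : ℤ, n ≠ 0 ∧ ∃ a, f a = n • b := by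
  have h1 := Submodule.finrank_quotient_add_finrank (LinearMap.range f.toIntLinearMap)
  rw [LinearMap.finrank_range_of_inj hf, h, Nat.add_eq_right,
    Module.finrank_eq_zero_iff] at h1
  obtain ⟨n, hn, hb⟩ := h1 (Submodule.Quotient.mk b)
  rw [← Submodule.Quotient.mk_smul, Submodule.Quotient.mk_eq_zero] at hb
  exact ⟨n, hn, hb⟩

namespace GradedPosets

variable {P : Type u} [PartialOrder P]

/-! ### Restriction maps -/

/-- The homomorphism `F(i) → F(j)` for `i ≤ j`. -/
abbrev arrow (F : P ⥤ AddCommGrpCat.{u}) {i j : P} (h : i ≤ j) : F.obj i →+ F.obj j :=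
  (F.map (homOfLE h)).hom

theorem arrow_arrow (F : P ⥤ AddCommGrpCat.{u}) {i j k : P} (h : i ≤ j) (h' : j ≤ k)
    (x : F.obj i) : arrow F h' (arrow F h x) = arrow F (h.trans h') x := by
  unfold arrow
  rw [← homOfLE_comp h h', F.map_comp]
  rfl

theorem arrow_refl (F : P ⥤ AddCommGrpCat.{u}) {i : P} (h : i ≤ i) (x : F.obj i) :
    arrow F h x = x := by
  have : homOfLE h = 𝟙 i := rfl
  unfold arrow
  rw [this, F.map_id]
  rfl

/-- The homomorphism `F(i) → ∏_{j ∈ S} F(j)` for a set `S` of objects above `i`. -/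
def restrict (F : P ⥤ AddCommGrpCat.{u}) (i : P) (S : Set P) (hS : ∀ j ∈ S, i ≤ j) :
    F.obj i →+ prodOver F S where
  toFun x j := arrow F (hS j j.2) x
  map_zero' := by funext j; exact map_zero _
  map_add' x y := by funext j; exact map_add _ x y

namespace Grading

/-! ### The degree function -/

theorem finite_Ici (g : Grading P) (i : P) : (Set.Ici i).Finite := by
  refine ((Set.finite_Iic (g.deg i)).biUnion fun n _ ↦ g.finite_above i n).subset fun j hj ↦ ?_
  simp only [Set.mem_iUnion]
  exact ⟨g.deg j, g.antitone hj, hj, rfl⟩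

theorem deg_lt_of_lt (g : Grading P) {i j : P} (h : i < j) : g.deg j < g.deg i := by
  have hfin : (Set.Ioc i j).Finite := (g.finite_Ici i).subset fun k hk ↦ hk.1.le
  obtain ⟨k, hk⟩ := hfin.exists_minimal ⟨j, h, le_rfl⟩
  have hcov : i ⋖ k := by
    refine ⟨hk.prop.1, fun l hil hlk ↦ ?_⟩
    exact hlk.not_ge (hk.le_of_le ⟨hil, hlk.le.trans hk.prop.2⟩ hlk.le)
  have := g.deg_of_covBy hcov
  have := g.antitone hk.prop.2
  omega

theorem eq_of_le_of_deg_le (g : Grading P) {i j : P} (h : i ≤ j) (hd : g.deg i ≤ g.deg j) : i = j := by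
  by_contra hne
  exact absurd (g.deg_lt_of_lt (lt_of_le_of_ne h hne)) hd.not_gt

theorem diagonal_surjective (g : Grading P) (p : ℕ) (F : P ⥤ AddCommGrpCat.{u}) {i : P} (hi : g.deg i ≤ p) :
    Function.Surjective (g.diagonal p F i) := by
  intro y
  have key : ∀ j : g.above i p, i = j.1 := fun j ↦
    g.eq_of_le_of_deg_le j.2.1 (hi.trans j.2.2.ge)
  by_cases h : i ∈ g.above i p
  · refine ⟨y ⟨i, h⟩, funext fun ⟨j, hj⟩ ↦ ?_⟩
    obtain rfl : i = j := key ⟨j, hj⟩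
    exact arrow_refl F hj.1 _
  · exact ⟨0, funext fun ⟨j, hj⟩ ↦ absurd ((key ⟨j, hj⟩).symm ▸ hj) h⟩

theorem nextFunctor_subsingleton (g : Grading P) (p : ℕ) (F : P ⥤ AddCommGrpCat.{u}) {i : P} (hi : g.deg i ≤ p) :
    Subsingleton ((g.nextFunctor p F).obj i) := by
  change Subsingleton (_ ⧸ (g.diagonal p F i).range)
  rw [AddMonoidHom.range_eq_top.mpr (g.diagonal_surjective p F hi)]
  exact QuotientAddGroup.subsingleton_quotient_top

/-! ### The local structure of the functors `F_p` -/

theorem IsCoveringFamily.le {g : Grading P} {J : P → ℕ → Set P} (hJ : g.IsCoveringFamily J)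
    {i : P} {p : ℕ} (hi : p ≤ g.deg i) : ∀ j ∈ J i p, i ≤ j :=
  fun _ hj ↦ (hJ.subset_above i p hi hj).1

theorem IsCoveringFamily.exists_mem {g : Grading P} {J : P → ℕ → Set P}
    (hJ : g.IsCoveringFamily J) {i k : P} {p : ℕ} (hi : p < g.deg i) (hk : k ∈ g.above i p) :
    ∃ j ∈ J i (p + 1), k ∈ g.above j p := by
  rw [← hJ.covering i p hi] at hk
  simpa only [Set.mem_iUnion, exists_prop] using hk

/-- `F` is determined by the covering family `J` in degree `p`: it restricts isomorphically to
`∏_{j ∈ J i p} F(j)` for all `i` of degree greater than `p`. -/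
def IsLocallyDetermined (g : Grading P) (J : P → ℕ → Set P) (p : ℕ) (F : P ⥤ AddCommGrpCat.{u}) :
    Prop :=
  ∀ i, p < g.deg i → ∀ hS : ∀ j ∈ J i p, i ≤ j, Function.Bijective (restrict F i (J i p) hS)

section

variable {g : Grading P} {J : P → ℕ → Set P} {p : ℕ} {F : P ⥤ AddCommGrpCat.{u}}

theorem IsLocallyDetermined.ext (hF : g.IsLocallyDetermined J p F) (hJ : g.IsCoveringFamily J)
    {i : P} (hi : p < g.deg i) {x y : F.obj i}
    (h : ∀ j ∈ J i p, ∀ hij : i ≤ j, arrow F hij x = arrow F hij y) : x = y :=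
  (hF i hi (hJ.le hi.le)).1 (funext fun j ↦ h j j.2 _)

theorem IsLocallyDetermined.exists_eq (hF : g.IsLocallyDetermined J p F)
    (hJ : g.IsCoveringFamily J) {i : P} (hi : p < g.deg i) (y : (j : g.above i p) → F.obj j) :
    ∃ x : F.obj i, ∀ (j : P) (_ : j ∈ J i p) (hj : j ∈ g.above i p),
      arrow F hj.1 x = y ⟨j, hj⟩ := by
  obtain ⟨x, hx⟩ := (hF i hi (hJ.le hi.le)).2 fun j ↦ y ⟨j, hJ.subset_above i p hi.le j.2⟩
  exact ⟨x, fun j hj _ ↦ congrFun hx ⟨j, hj⟩⟩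

/-- Every class in the cokernel of `F(i) → ∏_{j ∈ (i ↓ P)_p} F(j)` has a representative that
vanishes on `J i p`. -/
theorem IsLocallyDetermined.exists_rep (hF : g.IsLocallyDetermined J p F)
    (hJ : g.IsCoveringFamily J) {i : P} (hi : p < g.deg i) (w : (g.nextFunctor p F).obj i) :
    ∃ y : (j : g.above i p) → F.obj j, (QuotientAddGroup.mk y : _ ⧸ (g.diagonal p F i).range) = w ∧
      ∀ (j : P) (_ : j ∈ J i p) (hj : j ∈ g.above i p), y ⟨j, hj⟩ = 0 := by
  obtain ⟨y, rfl⟩ := QuotientAddGroup.mk_surjective w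
  obtain ⟨x, hx⟩ := hF.exists_eq hJ hi y
  refine ⟨y - g.diagonal p F i x, ?_, fun j hj hj' ↦ ?_⟩
  · rw [QuotientAddGroup.eq]
    exact ⟨x, by abel⟩
  · exact sub_eq_zero.mpr (hx j hj hj').symm

/-- If `y` restricts to the image of some `z_j ∈ F(j)` for every `j ∈ J i (p + 1)` and vanishes on
`J i p`, then each `z_j` vanishes on `J j p ⊆ J i p`, so `z_j = 0`, and `y = 0` by the covering
condition. -/
theorem IsLocallyDetermined.next_injective (hF : g.IsLocallyDetermined J p F)
    (hJ : g.IsCoveringFamily J) {i : P} (hi : p + 1 < g.deg i)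
    (hS : ∀ j ∈ J i (p + 1), i ≤ j) :
    Function.Injective (restrict (g.nextFunctor p F) i (J i (p + 1)) hS) := by
  have hp : p < g.deg i := by omega
  rw [injective_iff_map_eq_zero]
  intro w hw
  obtain ⟨y, rfl, hy⟩ := hF.exists_rep hJ hp w
  suffices y = 0 by rw [this]; rfl
  funext ⟨k, hk⟩
  obtain ⟨j, hj, hkj⟩ := hJ.exists_mem hp hk
  have hdj : g.deg j = p + 1 := (hJ.subset_above i (p + 1) hi.le hj).2
  have hw' : (QuotientAddGroup.mk (g.projection p F (hS j hj) y) : _ ⧸ (g.diagonal p F j).range) =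
    0 := congrFun hw ⟨j, hj⟩
  obtain ⟨z, hz⟩ := (QuotientAddGroup.eq_zero_iff _).mp hw'
  have hz0 : z = 0 := hF.ext hJ (by omega) fun l hl _ ↦ by
    have hl' := hJ.inheritance i p hp j hj hl
    rw [map_zero]
    exact (congrFun hz ⟨l, hJ.subset_above j p (by omega) hl⟩).trans (hy l hl' _)
  have := congrFun hz ⟨k, hkj⟩
  rw [hz0, map_zero] at this
  exact this.symm

/-- An element of `∏_{j ∈ J i (p + 1)} F_{p+1}(j)` with a nonzero multiple coming from
`F_{p+1}(i)` itself comes from `F_{p+1}(i)`. With representatives `y` and `u_j` that vanish on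
`J i p` and `J j p`, the equation between classes becomes the equation `n • u_j = y` between tuples,
so by torsion-freeness the `u_j` glue. -/
theorem IsLocallyDetermined.next_pure (hF : g.IsLocallyDetermined J p F)
    (hJ : g.IsCoveringFamily J) (htf : ∀ i, Module.IsTorsionFree ℤ (F.obj i))
    {i : P} (hi : p + 1 < g.deg i)
    (hS : ∀ j ∈ J i (p + 1), i ≤ j) (w : prodOver (g.nextFunctor p F) (J i (p + 1)))
    {n : ℤ} (hn : n ≠ 0) (x : (g.nextFunctor p F).obj i)
    (hx : restrict (g.nextFunctor p F) i (J i (p + 1)) hS x = n • w) :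
    w ∈ (restrict (g.nextFunctor p F) i (J i (p + 1)) hS).range := by
  have hp : p < g.deg i := by omega
  have hd : ∀ j : J i (p + 1), g.deg j = p + 1 := fun j ↦
    (hJ.subset_above i (p + 1) hi.le j.2).2
  obtain ⟨y, rfl, hy⟩ := hF.exists_rep hJ hp x
  choose u hu hu0 using fun j : J i (p + 1) ↦ hF.exists_rep hJ (by have := hd j; omega) (w j)
  have key : ∀ (j : J i (p + 1)) (k : g.above j p),
      n • u j k = y ⟨k, (hS j j.2).trans k.2.1, k.2.2⟩ := by
    intro j k
    have hj : (QuotientAddGroup.mk (g.projection p F (hS j j.2) y) :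
        _ ⧸ (g.diagonal p F j).range) = QuotientAddGroup.mk (n • u j) := by
      refine (congrFun hx j).trans ?_
      change n • w j = _
      rw [← hu j]
      rfl
    rw [QuotientAddGroup.eq] at hj
    obtain ⟨z, hz⟩ := hj
    have hz0 : z = 0 := hF.ext hJ (by have := hd j; omega) fun l hl _ ↦ by
      have hl' := hJ.inheritance i p hp j j.2 hl
      have hl2 := hJ.subset_above j p (by have := hd j; omega) hl
      rw [map_zero]
      refine (congrFun hz ⟨l, hl2⟩).trans ?_
      have hl3 : l ∈ g.above i p := ⟨(hS j j.2).trans hl2.1, hl2.2⟩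
      change -(y ⟨l, hl3⟩ : F.obj l) + n • (u j ⟨l, hl2⟩ : F.obj l) = 0
      rw [hy l hl', hu0 j l hl, smul_zero, neg_zero, add_zero]
    rw [hz0, map_zero] at hz
    have h1 : (0 : F.obj k) = -(y ⟨k, _⟩ : F.obj k) + n • (u j k : F.obj k) := congrFun hz k
    rw [eq_comm, neg_add_eq_zero] at h1
    exact h1.symm
  choose c hc hc' using fun k : g.above i p ↦ hJ.exists_mem hp k.2
  refine ⟨QuotientAddGroup.mk fun k ↦ u ⟨c k, hc k⟩ ⟨k, hc' k⟩, funext fun j ↦ ?_⟩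
  rw [← hu j]
  refine congrArg (QuotientAddGroup.mk (s := (g.diagonal p F j).range)) (funext fun k ↦ ?_)
  have := htf k
  exact smul_right_injective (F.obj k) hn ((key _ _).trans (key j k).symm)

/-- If `n • y` comes from `z ∈ F(i)` and `y` vanishes on `J i p`, then so does `z`, whence
`z = 0`. -/
theorem IsLocallyDetermined.next_isTorsionFree (hF : g.IsLocallyDetermined J p F)
    (hJ : g.IsCoveringFamily J) (htf : ∀ i, Module.IsTorsionFree ℤ (F.obj i)) (i : P) :
    Module.IsTorsionFree ℤ ((g.nextFunctor p F).obj i) := by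
  rcases le_or_gt (g.deg i) p with hi | hi
  · have := g.nextFunctor_subsingleton p F hi
    infer_instance
  · rw [Module.isTorsionFree_iff_smul_eq_zero]
    intro n w hw
    rw [or_iff_not_imp_left]
    intro hn
    obtain ⟨y, rfl, hy⟩ := hF.exists_rep hJ hi w
    have hw' : (QuotientAddGroup.mk (n • y) : _ ⧸ (g.diagonal p F i).range) = 0 := hw
    obtain ⟨z, hz⟩ := (QuotientAddGroup.eq_zero_iff _).mp hw'
    have hz0 : z = 0 := hF.ext hJ hi fun l hl hl' ↦ by
      have hl2 := hJ.subset_above i p hi.le hl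
      rw [map_zero]
      refine (congrFun hz ⟨l, hl2⟩).trans ?_
      change n • y _ = 0
      rw [hy l hl, smul_zero]
    suffices y = 0 by rw [this]; rfl
    rw [hz0, map_zero] at hz
    funext k
    have := htf k
    exact (smul_eq_zero.mp (congrFun hz k).symm).resolve_left hn

theorem IsLocallyDetermined.diagonal_injective (hF : g.IsLocallyDetermined J p F)
    (hJ : g.IsCoveringFamily J) (h0 : ∀ i, g.deg i < p → Subsingleton (F.obj i)) (i : P) :
    Function.Injective (g.diagonal p F i) := by
  intro x y hxy
  rcases lt_trichotomy (g.deg i) p with hi | hi | hi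
  · have := h0 i hi
    exact Subsingleton.elim _ _
  · have h1 : arrow F le_rfl x = arrow F le_rfl y := congrFun hxy ⟨i, le_rfl, hi⟩
    rwa [arrow_refl, arrow_refl] at h1
  · exact hF.ext hJ hi fun j hj hij ↦ congrFun hxy ⟨j, hJ.subset_above i p hi.le hj⟩

end

/-- The properties of `F_p` that the induction on `p` carries along. -/
structure IsRanked (g : Grading P) (J : P → ℕ → Set P) (p : ℕ) (F : P ⥤ AddCommGrpCat.{u}) :
    Prop where
  subsingleton : ∀ i, g.deg i < p → Subsingleton (F.obj i)
  free : ∀ i, Module.Free ℤ (F.obj i)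
  finite : ∀ i, Module.Finite ℤ (F.obj i)
  finrank : ∀ i, p ≤ g.deg i → (Module.finrank ℤ (F.obj i) : ℤ) = g.rankNumber p i
  determined : g.IsLocallyDetermined J p F

theorem IsRanked.diagonal_injective {g : Grading P} {J : P → ℕ → Set P} {p : ℕ}
    {F : P ⥤ AddCommGrpCat.{u}} (hF : g.IsRanked J p F) (hJ : g.IsCoveringFamily J) (i : P) :
    Function.Injective (g.diagonal p F i) :=
  hF.determined.diagonal_injective hJ hF.subsingleton i

section

variable {g : Grading P} {J : P → ℕ → Set P} {p : ℕ} {F : P ⥤ AddCommGrpCat.{u}}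
  {S : Set P}

theorem support_finrank (hfin : ∀ i, p ≤ g.deg i →
    (Module.finrank ℤ (F.obj i) : ℤ) = g.rankNumber p i) (hS : S ⊆ g.level p)
    (h : {i ∈ S | g.rankNumber p i ≠ 0}.Finite) :
    {i : S | Module.finrank ℤ (F.obj i) ≠ 0}.Finite := by
  refine (h.preimage (f := ((↑) : S → P)) Subtype.val_injective.injOn).subset fun i hi ↦ ?_
  refine ⟨i.2, ?_⟩
  rw [← hfin i (hS i.2).ge]
  exact_mod_cast hi

theorem finrank_prodOver [∀ i, Module.Free ℤ (F.obj i)] [∀ i, Module.Finite ℤ (F.obj i)]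
    (hfin : ∀ i, p ≤ g.deg i →
    (Module.finrank ℤ (F.obj i) : ℤ) = g.rankNumber p i) (hS : S ⊆ g.level p)
    (h : {i ∈ S | g.rankNumber p i ≠ 0}.Finite) :
    (Module.finrank ℤ (prodOver F S) : ℤ) = ∑ᶠ i ∈ S, g.rankNumber p i := by
  have hs := support_finrank hfin hS h
  rw [finrank_pi_of_finite_support hs, ← finsum_set_coe_eq_finsum_mem]
  exact ((Nat.castAddMonoidHom ℤ).map_finsum hs).trans
    (finsum_congr fun i ↦ hfin i (hS i.2).ge)

end

theorem above_subset_level (g : Grading P) (i : P) (p : ℕ) : g.above i p ⊆ g.level p :=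
  fun _ h ↦ h.2

/-- The covering condition makes `F_{p+1}(i) → ∏_{j ∈ J i (p + 1)} F_{p+1}(j)` injective with
torsion-free cokernel, and the rank equation then makes it bijective. -/
theorem isRanked_seqFunctor {g : Grading P} {J : P → ℕ → Set P}
    (hJ : g.IsAdequateCoveringFamily J) (p : ℕ) : g.IsRanked J p (g.seqFunctor p) := by
  have hJ' := hJ.toIsCoveringFamily
  induction p with
  | zero =>
    refine ⟨fun i hi ↦ absurd hi (Nat.not_lt_zero _),
      fun i ↦ inferInstanceAs (Module.Free ℤ (ULift.{u} ℤ)),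
      fun i ↦ inferInstanceAs (Module.Finite ℤ (ULift.{u} ℤ)), fun i _ ↦ ?_, fun i hi hS ↦ ?_⟩
    · change ((Module.finrank ℤ (ULift.{u} ℤ) : ℕ) : ℤ) = 1
      simp
    · -- `R^i_0 = 1` forces `J i 0` to have exactly one element.
      have h1 : (1 : ℤ) = ∑ᶠ j ∈ J i 0, 1 := hJ.rankNumber_eq i 0 hi
      have hfin : (J i 0).Finite :=
        (g.finite_above i 0).subset (hJ'.subset_above i 0 (Nat.zero_le _))
      rw [finsum_mem_eq_finite_toFinset_sum _ hfin, Finset.sum_const, nsmul_one] at h1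
      have h2 : (J i 0).ncard = 1 := by
        rw [Set.ncard_eq_toFinset_card _ hfin]
        exact_mod_cast h1.symm
      obtain ⟨j, hj⟩ := Set.ncard_eq_one.mp h2
      refine ⟨fun x y h ↦ congrFun h ⟨j, hj ▸ rfl⟩, fun y ↦ ⟨y ⟨j, hj ▸ rfl⟩, ?_⟩⟩
      funext ⟨k, hk⟩
      obtain rfl : k = j := by rwa [hj] at hk
      rfl
  | succ p ih =>
    have hfree := ih.free
    have hfinite := ih.finite
    have habove : ∀ i, {j ∈ g.above i p | g.rankNumber p j ≠ 0}.Finite := fun i ↦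
      (g.finite_above i p).subset fun j hj ↦ hj.1
    have hfg : ∀ i, Module.Finite ℤ ((j : g.above i p) → (g.seqFunctor p).obj j) := fun i ↦
      finite_pi_of_finite_support
        (support_finrank ih.finrank (g.above_subset_level i p) (habove i))
    have hfinite' : ∀ i, Module.Finite ℤ ((g.seqFunctor (p + 1)).obj i) := fun i ↦
      Module.Finite.of_surjective
        (QuotientAddGroup.mk' (g.diagonal p (g.seqFunctor p) i).range).toIntLinearMap
        (QuotientAddGroup.mk'_surjective _)
    have htf : ∀ i, Module.IsTorsionFree ℤ ((g.seqFunctor p).obj i) := fun i ↦ inferInstance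
    have htf' : ∀ i, Module.IsTorsionFree ℤ ((g.seqFunctor (p + 1)).obj i) :=
      ih.determined.next_isTorsionFree hJ' htf
    have hfree' : ∀ i, Module.Free ℤ ((g.seqFunctor (p + 1)).obj i) := fun i ↦ inferInstance
    have hrank : ∀ i, p + 1 ≤ g.deg i →
        (Module.finrank ℤ ((g.seqFunctor (p + 1)).obj i) : ℤ) = g.rankNumber (p + 1) i := by
      intro i hi
      have h1 := Submodule.finrank_quotient_add_finrank
        (LinearMap.range (g.diagonal p (g.seqFunctor p) i).toIntLinearMap)
      rw [LinearMap.finrank_range_of_inj (ih.diagonal_injective hJ' i)] at h1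
      change Module.finrank ℤ ((g.seqFunctor (p + 1)).obj i) + _ =
        Module.finrank ℤ (prodOver (g.seqFunctor p) (g.above i p)) at h1
      have h2 := finrank_prodOver ih.finrank (g.above_subset_level i p) (habove i)
      rw [← h1, Nat.cast_add, ih.finrank i (by omega)] at h2
      exact eq_sub_of_add_eq h2
    refine ⟨fun i hi ↦ g.nextFunctor_subsingleton p _ (by omega), hfree', hfinite', hrank, ?_⟩
    intro i hi hS
    have hinj := ih.determined.next_injective hJ' hi hS
    refine ⟨hinj, fun w ↦ ?_⟩
    have hsub : J i (p + 1) ⊆ g.level (p + 1) := fun j hj ↦ (hJ'.subset_above i _ hi.le hj).2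
    have hJfin : {j ∈ J i (p + 1) | g.rankNumber (p + 1) j ≠ 0}.Finite :=
      (g.finite_above i (p + 1)).subset fun j hj ↦ hJ'.subset_above i _ hi.le hj.1
    have : Module.Finite ℤ (prodOver (g.seqFunctor (p + 1)) (J i (p + 1))) :=
      finite_pi_of_finite_support (support_finrank hrank hsub hJfin)
    have heq : Module.finrank ℤ ((g.seqFunctor (p + 1)).obj i) =
        Module.finrank ℤ (prodOver (g.seqFunctor (p + 1)) (J i (p + 1))) := by
      have := (hrank i hi.le).trans (hJ.rankNumber_eq i (p + 1) hi)
      rw [← finrank_prodOver hrank hsub hJfin] at this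
      exact_mod_cast this
    obtain ⟨n, hn, x, hx⟩ := exists_smul_mem_range_of_finrank_eq
      (restrict (g.seqFunctor (p + 1)) i (J i (p + 1)) hS) hinj heq w
    exact ih.determined.next_pure hJ' htf hi hS w hn x hx

end Grading

/-- The image of a pure homomorphism contains every element that has a nonzero multiple in it. -/
theorem IsPure.mem_range {A B : Type u} [AddCommGroup A] [AddCommGroup B] {f : A →+ B}
    (hf : IsPure f) {n : ℤ} (hn : n ≠ 0) {a : A} {b : B} (h : f a = n • b) : b ∈ f.range := by
  unfold IsPure at hf
  have h0 : n • (QuotientAddGroup.mk' f.range b) = 0 := by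
    rw [← map_zsmul, ← h]
    exact (QuotientAddGroup.eq_zero_iff _).mpr ⟨a, rfl⟩
  exact (QuotientAddGroup.eq_zero_iff b).mp ((smul_eq_zero_iff_right hn).mp h0)

namespace Grading

/-! ### Global covering families and the surjectivity of `ω_p` -/

section

variable {g : Grading P} {K : ℕ → Set P} {p : ℕ}

/-- `lim` is left exact on `0 → F_p → ker' F_p → F_{p+1}`. -/
theorem exists_lim_of_omega_eq_zero
    (hinj : ∀ i, Function.Injective (g.diagonal p (g.seqFunctor p) i))
    {x : prodOver (g.seqFunctor p) (g.level p)} (hx : g.omega p x = 0) :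
    ∃ y : lim (g.seqFunctor p), limRestrict (g.seqFunctor p) (g.level p) y = x := by
  have h : ∀ i, ∃ z, g.diagonal p (g.seqFunctor p) i z =
      fun j : g.above i p ↦ x ⟨j.1, j.2.2⟩ := fun i ↦
    (QuotientAddGroup.eq_zero_iff _).mp (congrFun (congrArg Subtype.val hx) i)
  choose z hz using h
  refine ⟨⟨z, fun i k f ↦ hinj k ?_⟩, funext fun i ↦ ?_⟩
  · refine (g.projection_diagonal p _ (leOfHom f) (z i)).symm.trans ?_
    rw [hz, hz]
    rfl
  · have := congrFun (hz i) ⟨i, le_rfl, i.2⟩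
    exact (arrow_refl _ le_rfl _).symm.trans this

/-- A tuple vanishing on `K p` and killed by `ω_{p+1}` is an element of `lim F_p` that vanishes on
`K p`. -/
theorem limRestrict_omega_extendZero_injective (hK : g.IsGlobalCoveringFamily K)
    (hinj : ∀ i, Function.Injective (g.diagonal p (g.seqFunctor p) i)) :
    Function.Injective ((limRestrict (g.seqFunctor (p + 1)) (K (p + 1))).comp
      ((g.omega p).comp (g.extendZero p (K p)))) := by
  rw [injective_iff_map_eq_zero]
  intro x hx
  have h1 : g.omega p (g.extendZero p (K p) x) = 0 :=
    hK.restrict_injective (p + 1) (hx.trans (map_zero _).symm)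
  obtain ⟨y, hy⟩ := exists_lim_of_omega_eq_zero hinj h1
  have hy0 : y = 0 := hK.restrict_injective p <| funext fun i ↦ by
    exact (congrFun hy ⟨i, hK.subset_level p i.2⟩).trans (dif_pos i.2)
  rw [hy0, map_zero] at hy
  funext i
  exact ((congrFun hy ⟨i, i.2.1⟩).trans (dif_neg i.2.2)).symm

/-- An injective pure homomorphism between free groups of the same finite rank is surjective. -/
theorem limRestrict_omega_extendZero_surjective {J : P → ℕ → Set P}
    (hJ : g.IsAdequateCoveringFamily J) (hK : g.IsAdequateGlobalCoveringFamily K) :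
    Function.Surjective ((limRestrict (g.seqFunctor (p + 1)) (K (p + 1))).comp
      ((g.omega p).comp (g.extendZero p (K p)))) := by
  have hp := isRanked_seqFunctor hJ p
  have hp' := isRanked_seqFunctor hJ (p + 1)
  have := hp.free
  have := hp.finite
  have := hp'.free
  have := hp'.finite
  have hinj := limRestrict_omega_extendZero_injective hK.toIsGlobalCoveringFamily
    (hp.diagonal_injective hJ.toIsCoveringFamily)
  have hsub := hK.subset_level p
  have hsub' := hK.subset_level (p + 1)
  have hdsub : g.level p \ K p ⊆ g.level p := Set.sdiff_subset
  have hKfin : {i ∈ K p | g.rankNumber p i ≠ 0}.Finite :=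
    (hK.finite_support p).subset fun i hi ↦ ⟨hsub hi.1, hi.2⟩
  have hdfin : {i ∈ g.level p \ K p | g.rankNumber p i ≠ 0}.Finite :=
    (hK.finite_support p).subset fun i hi ↦ ⟨hdsub hi.1, hi.2⟩
  have hKfin' : {i ∈ K (p + 1) | g.rankNumber (p + 1) i ≠ 0}.Finite :=
    (hK.finite_support (p + 1)).subset fun i hi ↦ ⟨hsub' hi.1, hi.2⟩
  have : Module.Finite ℤ (prodOver (g.seqFunctor (p + 1)) (K (p + 1))) :=
    finite_pi_of_finite_support (support_finrank hp'.finrank hsub' hKfin')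
  have hrank : Module.finrank ℤ (prodOver (g.seqFunctor p) (g.level p \ K p)) =
      Module.finrank ℤ (prodOver (g.seqFunctor (p + 1)) (K (p + 1))) := by
    have h1 := finrank_prodOver hp.finrank hdsub hdfin
    have h2 := finrank_prodOver hp'.finrank hsub' hKfin'
    have h3 := hK.sum_eq p
    have h4 : ∑ᶠ i ∈ g.level p, g.rankNumber p i =
        (∑ᶠ i ∈ K p, g.rankNumber p i) + ∑ᶠ i ∈ g.level p \ K p, g.rankNumber p i := by
      rw [← finsum_mem_union' Set.disjoint_sdiff_right hKfin hdfin, Set.union_sdiff_cancel hsub]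
    have : (Module.finrank ℤ (prodOver (g.seqFunctor p) (g.level p \ K p)) : ℤ) =
      Module.finrank ℤ (prodOver (g.seqFunctor (p + 1)) (K (p + 1))) := by linarith
    exact_mod_cast this
  intro w
  obtain ⟨n, hn, x, hx⟩ := exists_smul_mem_range_of_finrank_eq _ hinj hrank w
  exact (hK.omega_pure p).mem_range hn hx

theorem exists_omega_extendZero {J : P → ℕ → Set P}
    (hJ : g.IsAdequateCoveringFamily J) (hK : g.IsAdequateGlobalCoveringFamily K)
    (y : lim (g.seqFunctor (p + 1))) : ∃ x, g.omega p (g.extendZero p (K p) x) = y := by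
  obtain ⟨x, hx⟩ := limRestrict_omega_extendZero_surjective hJ hK (limRestrict _ _ y)
  exact ⟨x, hK.restrict_injective (p + 1) hx⟩

theorem omega_surjective {J : P → ℕ → Set P}
    (hJ : g.IsAdequateCoveringFamily J) (hK : g.IsAdequateGlobalCoveringFamily K) :
    Function.Surjective (g.omega p) := fun y ↦
  let ⟨_, hx⟩ := exists_omega_extendZero hJ hK y
  ⟨_, hx⟩

/-- Since a tuple over `Ob_p(P)` can be moved into `ker ω_{p+1} = lim F_p` by a tuple vanishing on
`K p`, every tuple over `K p` extends to an element of `lim F_p`. -/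
theorem limRestrict_bijective {J : P → ℕ → Set P}
    (hJ : g.IsAdequateCoveringFamily J) (hK : g.IsAdequateGlobalCoveringFamily K) :
    Function.Bijective (limRestrict (g.seqFunctor p) (K p)) := by
  classical
  refine ⟨hK.restrict_injective p, fun y ↦ ?_⟩
  let x : prodOver (g.seqFunctor p) (g.level p) := fun i ↦ if h : i.1 ∈ K p then y ⟨i, h⟩ else 0
  obtain ⟨z, hz⟩ := exists_omega_extendZero hJ hK (g.omega p x)
  obtain ⟨w, hw⟩ := exists_lim_of_omega_eq_zero (x := x - g.extendZero p (K p) z)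
    ((isRanked_seqFunctor hJ p).diagonal_injective hJ.toIsCoveringFamily)
    (by rw [map_sub, hz, sub_self])
  refine ⟨w, funext fun i ↦ ?_⟩
  refine (congrFun hw ⟨i, hK.subset_level p i.2⟩).trans ?_
  have h1 : x ⟨i, hK.subset_level p i.2⟩ = y i := dif_pos i.2
  have h2 : g.extendZero p (K p) z ⟨i, hK.subset_level p i.2⟩ = 0 := dif_pos i.2
  rw [Pi.sub_apply, h1, h2, sub_zero]

end

end Grading

/-! ### Cochains -/

theorem differential_apply (F : P ⥤ AddCommGrpCat.{u}) (n : ℕ) (f : Cochain F n)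
    (σ : Fin (n + 2) →o P) : differential F n f σ = ∑ k : Fin (n + 2), (-1 : ℤ) ^ (k : ℕ) •
      arrow F (σ.monotone (Fin.le_last (k.succAbove (Fin.last n))))
        (f (σ.comp k.succAboveOrderEmb.toOrderHom)) := by
  simp only [differential, AddMonoidHom.finsetSum_apply, Finset.sum_apply]
  rfl

/-- The cosimplicial group of cochains, whose alternating coface map complex has the differentials
`differential F`. -/
def cochainCosimplicial (F : P ⥤ AddCommGrpCat.{u}) : CosimplicialObject AddCommGrpCat.{u} where
  obj n := AddCommGrpCat.of (Cochain F n.len)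
  map {m n} θ := AddCommGrpCat.ofHom
    { toFun := fun f σ ↦ arrow F (σ.monotone (Fin.le_last (θ.toOrderHom (Fin.last m.len))))
        (f (σ.comp θ.toOrderHom))
      map_zero' := by funext σ; exact map_zero _
      map_add' := fun f f' ↦ by funext σ; exact map_add _ _ _ }
  map_id n := by
    ext f σ
    exact arrow_refl F le_rfl (f σ)
  map_comp θ θ' := by
    ext f σ
    exact (arrow_arrow F _ _ _).symm

theorem differential_differential (F : P ⥤ AddCommGrpCat.{u}) (n : ℕ) (f : Cochain F n) :
    differential F (n + 1) (differential F n f) = 0 := by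
  have hd : ∀ m, AlgebraicTopology.AlternatingCofaceMapComplex.objD (cochainCosimplicial F) m =
      AddCommGrpCat.ofHom (differential F m) := fun m ↦ by
    refine AddCommGrpCat.homAddEquiv.injective ?_
    rw [AlgebraicTopology.AlternatingCofaceMapComplex.objD, map_sum]
    rfl
  have h := AlgebraicTopology.AlternatingCofaceMapComplex.d_squared (cochainCosimplicial F) n
  rw [hd, hd] at h
  exact congrArg (fun φ ↦ φ.hom f) h

/-- The map on cochains induced by a natural transformation. -/
def cochainMap {F G : P ⥤ AddCommGrpCat.{u}} (α : F ⟶ G) (n : ℕ) : Cochain F n →+ Cochain G n where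
  toFun f σ := (α.app _).hom (f σ)
  map_zero' := by funext σ; exact map_zero _
  map_add' f f' := by funext σ; exact map_add _ _ _

theorem differential_cochainMap {F G : P ⥤ AddCommGrpCat.{u}} (α : F ⟶ G) (n : ℕ)
    (f : Cochain F n) :
    differential G n (cochainMap α n f) = cochainMap α (n + 1) (differential F n f) := by
  funext σ
  change _ = (α.app _).hom (differential F n f σ)
  rw [differential_apply, differential_apply, map_sum]
  refine Finset.sum_congr rfl fun k _ ↦ ?_
  rw [map_zsmul]
  congr 1
  exact (congrArg (fun φ ↦ φ.hom (f (σ.comp k.succAboveOrderEmb.toOrderHom)))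
    (α.naturality (homOfLE (σ.monotone (Fin.le_last (k.succAbove (Fin.last n))))))).symm

/-- `lim^{n+1} F = 0`, that is, every `(n + 1)`-cocycle is a coboundary. -/
def HigherLimVanishes (F : P ⥤ AddCommGrpCat.{u}) (n : ℕ) : Prop :=
  ∀ f : Cochain F (n + 1), differential F (n + 1) f = 0 → ∃ e, differential F n e = f

theorem HigherLimVanishes.subsingleton {F : P ⥤ AddCommGrpCat.{u}} {n : ℕ}
    (h : HigherLimVanishes F n) : Subsingleton (HigherLim F (n + 1)) := by
  have htop : (coboundaries F (n + 1)).addSubgroupOf (differential F (n + 1)).ker = ⊤ := by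
    rw [AddSubgroup.addSubgroupOf_eq_top]
    exact fun f hf ↦ h f hf
  unfold HigherLim
  rw [htop]
  exact QuotientAddGroup.subsingleton_quotient_top

/-! ### The long exact sequence -/

section

variable {F G H : P ⥤ AddCommGrpCat.{u}} {α : F ⟶ G} {β : G ⟶ H} {n : ℕ}

theorem exists_cochainMap_eq (hβ : ∀ i, Function.Surjective (β.app i).hom) (f : Cochain H n) :
    ∃ f', cochainMap β n f' = f := by
  choose f' hf' using fun σ ↦ hβ _ (f σ)
  exact ⟨f', funext hf'⟩

theorem cochainMap_injective (hα : ∀ i, Function.Injective (α.app i).hom) :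
    Function.Injective (cochainMap α n) :=
  fun _ _ h ↦ funext fun σ ↦ hα _ (congrFun h σ)

theorem exists_cochainMap_of_eq_zero
    (hex : ∀ i (x : G.obj i), (β.app i).hom x = 0 → ∃ y, (α.app i).hom y = x) {f : Cochain G n}
    (hf : cochainMap β n f = 0) : ∃ f', cochainMap α n f' = f := by
  choose f' hf' using fun σ ↦ hex _ (f σ) (congrFun hf σ)
  exact ⟨f', funext hf'⟩

/-- For `0 → F → G → H → 0` exact with `lim^{n+1} G = 0`, one has `lim^{n+1} F = 0` once every
`n`-cocycle of `H` lifts to an `n`-cocycle of `G`. -/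
theorem HigherLimVanishes.of_exact (hα : ∀ i, Function.Injective (α.app i).hom)
    (hβα : ∀ i x, (β.app i).hom ((α.app i).hom x) = 0)
    (hex : ∀ i (x : G.obj i), (β.app i).hom x = 0 → ∃ y, (α.app i).hom y = x)
    (hG : HigherLimVanishes G n)
    (hlift : ∀ y : Cochain H n, differential H n y = 0 →
      ∃ x : Cochain G n, differential G n x = 0 ∧ cochainMap β n x = y) :
    HigherLimVanishes F n := by
  intro f hf
  obtain ⟨e, he⟩ := hG (cochainMap α (n + 1) f) (by rw [differential_cochainMap, hf, map_zero])
  obtain ⟨x, hx, hxe⟩ := hlift (cochainMap β n e) (by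
    rw [differential_cochainMap, he]
    exact funext fun σ ↦ hβα _ _)
  obtain ⟨e', he'⟩ := exists_cochainMap_of_eq_zero hex (f := e - x) (by
    rw [map_sub, hxe, sub_self])
  refine ⟨e', cochainMap_injective hα ?_⟩
  rw [← differential_cochainMap, he', map_sub, he, hx, sub_zero]

theorem HigherLimVanishes.exists_lift (hβ : ∀ i, Function.Surjective (β.app i).hom)
    (hH : HigherLimVanishes H n) (y : Cochain H (n + 1)) (hy : differential H (n + 1) y = 0) :
    ∃ x : Cochain G (n + 1), differential G (n + 1) x = 0 ∧ cochainMap β (n + 1) x = y := by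
  obtain ⟨e, rfl⟩ := hH y hy
  obtain ⟨e', rfl⟩ := exists_cochainMap_eq hβ e
  exact ⟨differential G n e', differential_differential G n e',
    (differential_cochainMap β n e').symm⟩

end

/-! ### The zeroth cohomology -/

section

variable {F : P ⥤ AddCommGrpCat.{u}}

theorem arrow_cochain_congr {n : ℕ} (f : Cochain F n) {σ τ : Fin (n + 1) →o P} (h : σ = τ) {j : P}
    (hσ : σ (Fin.last n) ≤ j) (hτ : τ (Fin.last n) ≤ j) : arrow F hσ (f σ) = arrow F hτ (f τ) := by
  subst h
  rfl

/-- A `0`-simplex is determined by its only vertex. -/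
theorem cochain_const_apply (f : Cochain F 0) (σ : Fin 1 →o P) :
    f (OrderHom.const (Fin 1) (σ (Fin.last 0))) = f σ := by
  have h : OrderHom.const (Fin 1) (σ (Fin.last 0)) = σ := by
    ext a
    exact congrArg σ (Subsingleton.elim (α := Fin 1) _ _)
  exact (arrow_refl F le_rfl _).symm.trans
    ((arrow_cochain_congr f h le_rfl le_rfl).trans (arrow_refl F le_rfl (f σ)))

theorem lim_cocycle (x : lim F) : differential F 0 (fun σ ↦ x.1 (σ (Fin.last 0))) = 0 := by
  funext σ
  rw [differential_apply, Fin.sum_univ_two]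
  have h : ∀ (i : P) (h : i ≤ σ (Fin.last 1)), arrow F h (x.1 i) = x.1 (σ (Fin.last 1)) :=
    fun i h ↦ x.2 i _ (homOfLE h)
  refine (congrArg₂ (fun a b ↦ (-1 : ℤ) ^ ((0 : Fin 2) : ℕ) • a + (-1 : ℤ) ^ ((1 : Fin 2) : ℕ) • b)
    (h _ _) (h _ _)).trans ?_
  simp

theorem cocycle_compatible {f : Cochain F 0} (hf : differential F 0 f = 0) :
    (fun i ↦ f (OrderHom.const (Fin 1) i) : (i : P) → F.obj i) ∈ lim F := by
  intro i j h
  let σ : Fin 2 →o P := ⟨![i, j], by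
    intro a b hab
    fin_cases a <;> fin_cases b <;>
      first | exact le_rfl | exact leOfHom h | exact absurd hab (by decide)⟩
  have h1 := congrFun hf σ
  rw [differential_apply, Fin.sum_univ_two] at h1
  have e0 : σ.comp (Fin.succAboveOrderEmb (0 : Fin 2)).toOrderHom = OrderHom.const (Fin 1) j := by
    ext a
    fin_cases a
    rfl
  have e1 : σ.comp (Fin.succAboveOrderEmb (1 : Fin 2)).toOrderHom = OrderHom.const (Fin 1) i := by
    ext a
    fin_cases a
    rfl
  have key : ∀ a b : F.obj (σ (Fin.last 1)),
      (-1 : ℤ) ^ ((0 : Fin 2) : ℕ) • a + (-1 : ℤ) ^ ((1 : Fin 2) : ℕ) • b = 0 → a = b :=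
    fun a b hab ↦ by simpa [← sub_eq_add_neg, sub_eq_zero] using hab
  have h2 := key _ _ h1
  exact ((arrow_cochain_congr f e1 _ (leOfHom h)).symm.trans h2.symm).trans
    ((arrow_cochain_congr f e0 _ le_rfl).trans (arrow_refl F le_rfl _))

end

namespace Grading

/-! ### The acyclic functors `ker'` -/

/-- The functor `i ↦ ∏_{j ∈ (i ↓ P)_p} F(j)`. -/
def kerFunctor (g : Grading P) (p : ℕ) (F : P ⥤ AddCommGrpCat.{u}) : P ⥤ AddCommGrpCat.{u} where
  obj i := AddCommGrpCat.of ((j : g.above i p) → F.obj j)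
  map f := AddCommGrpCat.ofHom (g.projection p F (leOfHom f))
  map_id _ := rfl
  map_comp _ _ := rfl

/-- The natural transformation `F ⟶ ker' F` with components `diagonal`. -/
def diagonalTrans (g : Grading P) (p : ℕ) (F : P ⥤ AddCommGrpCat.{u}) :
    F ⟶ g.kerFunctor p F where
  app i := AddCommGrpCat.ofHom (g.diagonal p F i)
  naturality i k f := by
    ext x
    exact (g.projection_diagonal p F (leOfHom f) x).symm

/-- The quotient map `ker' F ⟶ nextFunctor F`. -/
def quotientTrans (g : Grading P) (p : ℕ) (F : P ⥤ AddCommGrpCat.{u}) :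
    g.kerFunctor p F ⟶ g.nextFunctor p F where
  app i := AddCommGrpCat.ofHom (QuotientAddGroup.mk' (g.diagonal p F i).range)
  naturality _ _ _ := rfl

/-- The simplex `σ_0 ≤ ... ≤ σ_n ≤ j`. -/
def cone {n : ℕ} (σ : Fin (n + 1) →o P) (j : P) (h : σ (Fin.last n) ≤ j) : Fin (n + 2) →o P where
  toFun := Fin.snoc (α := fun _ ↦ P) σ j
  monotone' a b hab := by
    induction b using Fin.lastCases with
    | last =>
      rw [Fin.snoc_last]
      induction a using Fin.lastCases with
      | last => rw [Fin.snoc_last]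
      | cast a => rw [Fin.snoc_castSucc]; exact (σ.monotone (Fin.le_last a)).trans h
    | cast b =>
      induction a using Fin.lastCases with
      | last => exact absurd hab (Fin.castSucc_lt_last b).not_ge
      | cast a =>
        rw [Fin.snoc_castSucc, Fin.snoc_castSucc]
        exact σ.monotone (Fin.castSucc_le_castSucc_iff.mp hab)

theorem cone_last {n : ℕ} (σ : Fin (n + 1) →o P) (j : P) (h : σ (Fin.last n) ≤ j) :
    cone σ j h (Fin.last (n + 1)) = j :=
  Fin.snoc_last (α := fun _ ↦ P) _ _

theorem cone_comp_succAbove_last {n : ℕ} (σ : Fin (n + 1) →o P) (j : P)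
    (h : σ (Fin.last n) ≤ j) :
    (cone σ j h).comp (Fin.succAboveOrderEmb (Fin.last (n + 1))).toOrderHom = σ := by
  ext a
  change Fin.snoc (α := fun _ ↦ P) σ j ((Fin.last (n + 1)).succAbove a) = σ a
  rw [Fin.succAbove_last, Fin.snoc_castSucc]

theorem cone_comp_succAbove_castSucc {n : ℕ} (σ : Fin (n + 2) →o P) (j : P)
    (h : σ (Fin.last (n + 1)) ≤ j) (k : Fin (n + 2))
    (h' : σ.comp (Fin.succAboveOrderEmb k).toOrderHom (Fin.last n) ≤ j) :
    (cone σ j h).comp (Fin.succAboveOrderEmb k.castSucc).toOrderHom =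
      cone (σ.comp (Fin.succAboveOrderEmb k).toOrderHom) j h' := by
  ext a
  change Fin.snoc (α := fun _ ↦ P) σ j (k.castSucc.succAbove a) =
    Fin.snoc (α := fun _ ↦ P) (fun b ↦ σ (k.succAbove b)) j a
  induction a using Fin.lastCases with
  | last => rw [Fin.succAbove_ne_last_last (Fin.castSucc_lt_last k).ne, Fin.snoc_last, Fin.snoc_last]
  | cast a => rw [Fin.castSucc_succAbove_castSucc, Fin.snoc_castSucc, Fin.snoc_castSucc]

/-- The value of a cochain of `ker' F` at a simplex, projected to `F(j)`, depends only on the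
simplex. -/
theorem kerFunctor_cochain_congr (g : Grading P) (p : ℕ) (F : P ⥤ AddCommGrpCat.{u}) {n : ℕ}
    (f : (σ : Fin (n + 1) →o P) → (j : g.above (σ (Fin.last n)) p) → F.obj j)
    {σ τ : Fin (n + 1) →o P} (h : σ = τ) (j : P) (hσ : j ∈ g.above (σ (Fin.last n)) p)
    (hτ : j ∈ g.above (τ (Fin.last n)) p) : f σ ⟨j, hσ⟩ = f τ ⟨j, hτ⟩ := by
  subst h
  rfl

theorem kerFunctor_differential_apply (g : Grading P) (p : ℕ) (F : P ⥤ AddCommGrpCat.{u}) {n : ℕ}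
    (f : Cochain (g.kerFunctor p F) n) (σ : Fin (n + 2) →o P)
    (j : g.above (σ (Fin.last (n + 1))) p) :
    (differential (g.kerFunctor p F) n f σ : (j : g.above (σ (Fin.last (n + 1))) p) → F.obj j) j =
      ∑ k : Fin (n + 2), (-1 : ℤ) ^ (k : ℕ) •
        (f (σ.comp k.succAboveOrderEmb.toOrderHom) :
          (j : g.above ((σ.comp k.succAboveOrderEmb.toOrderHom) (Fin.last n)) p) → F.obj j)
          ⟨j, (σ.monotone (Fin.le_last _)).trans j.2.1, j.2.2⟩ := by
  rw [differential_apply]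
  exact Finset.sum_apply (M := fun j : g.above (σ (Fin.last (n + 1))) p ↦ F.obj j) j _ _

/-- The functor `ker' F` is a product of functors supported on the cones `{i | i ≤ j}`; coning off
with `j` contracts its cochain complex. -/
theorem higherLimVanishes_kerFunctor (g : Grading P) (p : ℕ) (F : P ⥤ AddCommGrpCat.{u}) (n : ℕ) :
    HigherLimVanishes (g.kerFunctor p F) n := by
  intro f hf
  have hc : ∀ {m : ℕ} (σ : Fin (m + 1) →o P) (j : g.above (σ (Fin.last m)) p),
      j.1 ∈ g.above (cone σ j j.2.1 (Fin.last (m + 1))) p := fun σ j ↦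
    ⟨(cone_last σ j j.2.1).le, j.2.2⟩
  let e : Cochain (g.kerFunctor p F) n := fun σ j ↦
    (f (cone σ j j.2.1) :
      (j' : g.above (cone σ j j.2.1 (Fin.last (n + 1))) p) → F.obj j') ⟨j, hc σ j⟩
  -- The simplex `cone σ j` has `n + 3` vertices, so `σ` occurs in its boundary with sign
  -- `(-1) ^ (n + 2)`.
  refine ⟨(-1 : ℤ) ^ (n + 1) • e, ?_⟩
  rw [map_zsmul]
  funext σ
  refine funext fun j : g.above (σ (Fin.last (n + 1))) p ↦ ?_
  have h0 := kerFunctor_differential_apply g p F f (cone σ j j.2.1) ⟨j, hc σ j⟩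
  rw [hf, Fin.sum_univ_castSucc] at h0
  have h1 := kerFunctor_differential_apply g p F e σ j
  have h2 := h0.trans (congrArg₂ (· + ·)
    (Finset.sum_congr rfl fun k _ ↦ congrArg ((-1 : ℤ) ^ (k : ℕ) • ·)
      (kerFunctor_cochain_congr g p F f (cone_comp_succAbove_castSucc σ j j.2.1 k
        ((σ.monotone (Fin.le_last _)).trans j.2.1)) j _ (hc (σ.comp k.succAboveOrderEmb.toOrderHom)
        ⟨j, (σ.monotone (Fin.le_last _)).trans j.2.1, j.2.2⟩)))
    (congrArg ((-1 : ℤ) ^ (n + 2) • ·)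
      (kerFunctor_cochain_congr g p F f (cone_comp_succAbove_last σ j j.2.1) j _ j.2)))
  have h3 : ∀ a b : F.obj j, 0 = a + (-1 : ℤ) ^ (n + 2) • b → (-1 : ℤ) ^ (n + 1) • a = b := by
    intro a b hab
    rw [eq_neg_of_add_eq_zero_left hab.symm, smul_neg, smul_smul, ← neg_smul, ← pow_add,
      show n + 1 + (n + 2) = 2 * (n + 1) + 1 by ring, pow_succ, pow_mul]
    simp
  refine (congrArg ((-1 : ℤ) ^ (n + 1) • ·) h1).trans (h3 _ _ h2)

end Grading

/-- `lim^0 F` is the limit of `F`. -/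
def higherLimZeroEquiv (F : P ⥤ AddCommGrpCat.{u}) : HigherLim F 0 ≃+ lim F :=
  (QuotientAddGroup.quotientAddEquivOfEq (AddSubgroup.bot_addSubgroupOf _)).trans <|
    QuotientAddGroup.quotientBot.trans
      { toFun := fun f ↦ ⟨fun i ↦ f.1 (OrderHom.const (Fin 1) i), cocycle_compatible f.2⟩
        invFun := fun x ↦ ⟨fun σ ↦ x.1 (σ (Fin.last 0)), lim_cocycle x⟩
        left_inv := fun f ↦ Subtype.ext <| funext (cochain_const_apply f.1)
        right_inv := fun _ ↦ rfl
        map_add' := fun _ _ ↦ rfl }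

namespace Grading

/-! ### Acyclicity -/

section

variable {g : Grading P} {J : P → ℕ → Set P} {K : ℕ → Set P}

/-- Dimension shifting along `0 → F_p → ker' F_p → F_{p+1} → 0`: the groups `lim^{n+1} F_p` reduce
to `lim^1 F_{p+n}`, the cokernel of `ω_{p+n+1}`. -/
theorem higherLimVanishes_seqFunctor (hJ : g.IsAdequateCoveringFamily J)
    (hK : g.IsAdequateGlobalCoveringFamily K) (n p : ℕ) :
    HigherLimVanishes (g.seqFunctor p) n := by
  have hsurj : ∀ i, Function.Surjective ((g.quotientTrans p (g.seqFunctor p)).app i).hom :=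
    fun i ↦ QuotientAddGroup.mk'_surjective (g.diagonal p (g.seqFunctor p) i).range
  refine HigherLimVanishes.of_exact (α := g.diagonalTrans p (g.seqFunctor p))
    (β := g.quotientTrans p (g.seqFunctor p))
    ((isRanked_seqFunctor hJ p).diagonal_injective hJ.toIsCoveringFamily)
    (fun i x ↦ (QuotientAddGroup.eq_zero_iff _).mpr ⟨x, rfl⟩)
    (fun i x hx ↦ (QuotientAddGroup.eq_zero_iff _).mp hx)
    (g.higherLimVanishes_kerFunctor p _ n) ?_
  cases n with
  | succ n =>
    exact HigherLimVanishes.exists_lift hsurj (higherLimVanishes_seqFunctor hJ hK n (p + 1))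
  | zero =>
    intro y hy
    obtain ⟨x, hx⟩ := omega_surjective hJ hK (p := p) ⟨_, cocycle_compatible hy⟩
    let x' : lim (g.kerFunctor p (g.seqFunctor p)) :=
      ⟨fun i (j : g.above i p) ↦ x ⟨j.1, j.2.2⟩, fun _ _ _ ↦ rfl⟩
    refine ⟨_, lim_cocycle x', funext fun σ ↦ ?_⟩
    have h1 := congrFun (congrArg Subtype.val hx) (σ (Fin.last 0))
    exact h1.trans (cochain_const_apply y σ)

theorem isAcyclic (hJ : g.IsAdequateCoveringFamily J)
    (hK : g.IsAdequateGlobalCoveringFamily K) : IsAcyclic P := by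
  intro n hn
  obtain ⟨n, rfl⟩ := Nat.exists_eq_succ_of_ne_zero (Nat.one_le_iff_ne_zero.mp hn)
  exact (higherLimVanishes_seqFunctor hJ hK n 0).subsingleton

/-! ### Connected components -/

/-- An integer-valued function on the connected components is an element of `lim c_ℤ`. -/
def limOfComponents (φ : ConnectedComponents P → ℤ) : lim (constInt P) :=
  ⟨fun i ↦ ULift.up (φ (Quotient.mk'' i)), fun _ _ f ↦
    congrArg (fun c ↦ ULift.up (φ c)) (Quotient.sound (Zigzag.of_hom f))⟩

theorem eq_of_zigzag_of_mem_lim (x : lim (constInt P)) {i j : P} (h : Zigzag i j) :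
    (x.1 i : ULift.{u} ℤ) = x.1 j := by
  induction h with
  | refl => rfl
  | tail _ h ih =>
    refine ih.trans ?_
    rcases h with ⟨⟨f⟩⟩ | ⟨⟨f⟩⟩
    · exact x.2 _ _ f
    · exact (x.2 _ _ f).symm

/-- If `lim c_ℤ` restricts isomorphically to `S`, then `S` meets every connected component exactly
once, as indicator functions of components and of points of `S` show. -/
theorem bijective_component_of_limRestrict_bijective {S : Set P}
    (h : Function.Bijective (limRestrict (constInt P) S)) :
    Function.Bijective fun k : S ↦ (Quotient.mk'' k.1 : ConnectedComponents P) := by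
  classical
  constructor
  · intro k l hkl
    obtain ⟨x, hx⟩ := h.2 fun m ↦ ULift.up (if m = k then 1 else 0)
    have hk : (x.1 k : ULift.{u} ℤ) = ULift.up (if k = k then 1 else 0) := congrFun hx k
    have hl : (x.1 l : ULift.{u} ℤ) = ULift.up (if l = k then 1 else 0) := congrFun hx l
    rw [eq_of_zigzag_of_mem_lim x (Quotient.exact hkl), hl, if_pos rfl] at hk
    by_contra hne
    rw [if_neg (Ne.symm hne)] at hk
    exact zero_ne_one (congrArg ULift.down hk)
  · intro c
    by_contra! hc
    have h0 : limOfComponents (fun d : ConnectedComponents P ↦ if d = c then 1 else 0) = 0 := by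
      refine h.1 (funext fun k ↦ ?_)
      exact congrArg ULift.up (if_neg (hc k))
    obtain ⟨i, rfl⟩ := Quotient.exists_rep c
    have h1 := congrArg ULift.down (congrFun (congrArg Subtype.val h0) i)
    exact one_ne_zero ((if_pos rfl).symm.trans h1)

end

end Grading

end GradedPosets

theorem mainTheorem2 {P : Type u} [PartialOrder P] (g : GradedPosets.Grading P)
    (hg : g.BoundedBelow)
    (J : P → ℕ → Set P) (hJ : g.IsAdequateCoveringFamily J)
    (K : ℕ → Set P) (hK : g.IsAdequateGlobalCoveringFamily K) :
    (GradedPosets.IsAcyclic P ↔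
        Cardinal.mk (K 0) = Cardinal.mk (CategoryTheory.ConnectedComponents P)) ∧
      (GradedPosets.IsAcyclic P →
        Nonempty (GradedPosets.Cohomology P 0 ≃+ (K 0 → ℤ))) := by
  have hbij := GradedPosets.Grading.limRestrict_bijective hJ hK (p := 0)
  refine ⟨iff_of_true (GradedPosets.Grading.isAcyclic hJ hK) ?_, fun _ ↦ ⟨?_⟩⟩
  · exact Cardinal.mk_congr (Equiv.ofBijective _
      (GradedPosets.Grading.bijective_component_of_limRestrict_bijective hbij))
  · exact (GradedPosets.higherLimZeroEquiv (GradedPosets.Grading.constInt P)).trans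
      ((AddEquiv.ofBijective _ hbij).trans
        (AddEquiv.piCongrRight fun _ : K 0 ↦ (AddEquiv.ulift : ULift.{u} ℤ ≃+ ℤ)))
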